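/- Let $(K,\partial)$ be a differential field of characteristic zero, let $n\ge 0$, and let $K\{x_1,\dots,x_n\}=K[x_i^{(r)} : 1\le i\le n,\ r\ge 0]$ be the ring of differential polynomials, with the unique derivation extending $\partial$ on $K$ such that $\partial x_i^{(r)}=x_i^{(r+1)}$. Let $u_1,\dots,u_n\in K\{x_1,\dots,x_n\}$, let $[u_1,\dots,u_n]$ be the ideal generated by all $\partial^j u_i$ with $1\le i\le n$, $j\ge 0$, and put $A=K\{x_1,\dots,x_n\}/[u_1,\dots,u_n]$ and $\Sigma=\operatorname{Spec}A$. Let $\pi\colon T\Sigma=\operatorname{Spec}(\operatorname{Sym}_A\Omega_{A/K})\to\Sigma$ be the tangent bundle of $\Sigma$, and for $\eta\in\Sigma$ let $T\Sigma_\eta=\pi^{-1}(\eta)$ be the scheme-theoretic fibre, a scheme over the residue field $\kappa(\eta)$. Let $\Sigma_1$ be an irreducible component of $\Sigma$ with generic point $\eta_1$. Suppose that $\Sigma_1$ has finite Krull dimension and is generically reduced, i.e. the local ring $\mathcal{O}_{\Sigma,\eta_1}$ is reduced. Then $$\dim(\Sigma_1)=\dim(T\Sigma_{\eta_1}).$$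 Here the dimension of a scheme $X$ over a field $k$ is the supremum, over the irreducible components $Z$ of $X$, of the transcendence degree over $k$ of the function field of $Z$ with its reduced structure; $\Sigma_1$ is regarded as a scheme over $K$ (so $\dim(\Sigma_1)=\operatorname{trdeg}_K\kappa(\eta_1)$) and $T\Sigma_{\eta_1}$ as a scheme over $\kappa(\eta_1)$. In words, the dimension of $\Sigma_1$ equals the dimension of the tangent space at its generic point. -/

import Mathlib

open CategoryTheory AlgebraicGeometry TopologicalSpace
open scoped Differential

universe u

noncomputable section

namespace DiffScheme

/-! ### Differential polynomials and differential ideals -/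

/-- The ring `K{x_1, …, x_n}` of differential polynomials: polynomials over `K` in the countably many
variables `x_i^{(r)}`, where `x_i^{(r)}` is the variable with index `(i, r)`. -/
abbrev DiffPoly (K : Type u) [CommRing K] (n : ℕ) : Type u :=
  MvPolynomial (Fin n × ℕ) K

/-- The ring homomorphism `f ↦ f + ε ∂f` into the dual numbers over `K{x_1, …, x_n}`. It is determined
by `a ↦ a + ε a′` for constants `a` in `K` and by `x_i^{(r)} ↦ x_i^{(r)} + ε x_i^{(r+1)}`. -/
def jet (K : Type u) [CommRing K] [Differential K] (n : ℕ) :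
    DiffPoly K n →+* DualNumber (DiffPoly K n) :=
  MvPolynomial.eval₂Hom
    { toFun := fun a => (TrivSqZeroExt.inl (MvPolynomial.C a) +
        TrivSqZeroExt.inr (MvPolynomial.C a′) : DualNumber (DiffPoly K n))
      map_one' := by simp
      map_mul' := fun a b => by
        ext
        · simp
        · simp only [Derivation.leibniz, smul_eq_mul, map_add, map_mul]
          simp
          ring_nf
      map_zero' := by simp
      map_add' := fun a b => by
        ext <;> simp }
    (fun p => TrivSqZeroExt.inl (MvPolynomial.X p) +
      TrivSqZeroExt.inr (MvPolynomial.X (p.1, p.2 + 1)))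

theorem jet_fst {K : Type u} [CommRing K] [Differential K] {n : ℕ} (f : DiffPoly K n) :
    (jet K n f).fst = f := by
  induction f using MvPolynomial.induction_on with
  | C a => simp [jet]
  | add p q hp hq => simp [hp, hq]
  | mul_X p i hp =>
    rw [map_mul, TrivSqZeroExt.fst_mul, hp]
    simp [jet]

/-- The derivation `∂` of `K{x_1, …, x_n}`: the unique one that extends the derivation of `K` and
satisfies `∂ x_i^{(r)} = x_i^{(r+1)}` (see `deriv_C`, `deriv_X` and `deriv_unique`). -/
def deriv (K : Type u) [CommRing K] [Differential K] (n : ℕ) :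
    Derivation ℤ (DiffPoly K n) (DiffPoly K n) :=
  Derivation.mk'
    (AddMonoidHom.toIntLinearMap
      { toFun := fun f => (jet K n f).snd
        map_zero' := by simp
        map_add' := fun f g => by simp })
    (fun f g => by
      simp [jet_fst, mul_comm])

theorem deriv_C {K : Type u} [CommRing K] [Differential K] {n : ℕ} (a : K) :
    deriv K n (MvPolynomial.C a) = MvPolynomial.C a′ := by
  simp [deriv, jet]

theorem deriv_X {K : Type u} [CommRing K] [Differential K] {n : ℕ} (i : Fin n) (r : ℕ) :
    deriv K n (MvPolynomial.X (i, r)) = MvPolynomial.X (i, r + 1) := by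
  simp [deriv, jet]

theorem deriv_unique {K : Type u} [CommRing K] [Differential K] {n : ℕ}
    (D : Derivation ℤ (DiffPoly K n) (DiffPoly K n))
    (hC : ∀ a : K, D (MvPolynomial.C a) = MvPolynomial.C a′)
    (hX : ∀ (i : Fin n) (r : ℕ), D (MvPolynomial.X (i, r)) = MvPolynomial.X (i, r + 1)) :
    D = deriv K n := by
  ext1 f
  induction f using MvPolynomial.induction_on with
  | C a => rw [hC, deriv_C]
  | add p q hp hq => rw [map_add, map_add, hp, hq]
  | mul_X p i hp =>
    rw [Derivation.leibniz, Derivation.leibniz, hp, show i = (i.1, i.2) from rfl, hX, deriv_X]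

/-- The differential ideal `[u_1, …, u_n]`: the ideal generated by all derivatives `∂^j u_i` with
`j ≥ 0`. -/
def diffIdeal {K : Type u} [CommRing K] [Differential K] {n : ℕ} (u : Fin n → DiffPoly K n) :
    Ideal (DiffPoly K n) :=
  Ideal.span (Set.range fun p : Fin n × ℕ => (deriv K n)^[p.2] (u p.1))

/-- The quotient ring `K{x_1, …, x_n}/[u_1, …, u_n]`. -/
abbrev coordRing {K : Type u} [CommRing K] [Differential K] {n : ℕ} (u : Fin n → DiffPoly K n) :
    Type u :=
  DiffPoly K n ⧸ diffIdeal u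

/-! ### Dimension -/

/-- For a scheme `X` over `Spec k` and a point `x` of `X`, the transcendence degree over `k` of the
residue field of `X` at `x`. If `x` is the generic point of an irreducible component (or of any closed
irreducible subset) `Z`, the residue field is the function field of `Z` with its reduced structure,
so that this is the dimension of `Z` over `k`. -/
def pointDim {k : CommRingCat.{u}} {X : Scheme.{u}} (f : X ⟶ Spec k) (x : X) : Cardinal.{u} :=
  letI : Algebra k (X.residueField x) :=
    (Spec.preimage (X.fromSpecResidueField x ≫ f)).hom.toAlgebra
  Algebra.trdeg k (X.residueField x)

/-- The dimension of a scheme `X` over `Spec k`: the supremum, over the irreducible components `Z`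
of `X`, of the transcendence degree over `k` of the function field of `Z`. The components
are indexed by their generic points. -/
def dim {k : CommRingCat.{u}} {X : Scheme.{u}} (f : X ⟶ Spec k) : Cardinal.{u} :=
  ⨆ x : {x : X // closure {x} ∈ irreducibleComponents X}, pointDim f x.1

/-! ### Affine schemes over `K` and their tangent bundles -/

/-- The structure morphism `Spec A ⟶ Spec K`. -/
def structureMap (K A : Type u) [CommRing K] [CommRing A] [Algebra K A] :
    Spec (.of A) ⟶ Spec (.of K) :=
  Spec.map (CommRingCat.ofHom (algebraMap K A))

/-- The tangent bundle `T(Spec A) = Spec (Sym_A Ω_{A/K})`. -/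
def tangentBundle (K A : Type u) [CommRing K] [CommRing A] [Algebra K A] : Scheme.{u} :=
  Spec (.of (SymmetricAlgebra A (Ω[A⁄K])))

/-- The projection `π : T(Spec A) ⟶ Spec A`. -/
def tangentProj (K A : Type u) [CommRing K] [CommRing A] [Algebra K A] :
    tangentBundle K A ⟶ Spec (.of A) :=
  Spec.map (CommRingCat.ofHom (algebraMap A (SymmetricAlgebra A (Ω[A⁄K]))))

/-- The structure morphism `π⁻¹(η) ⟶ Spec κ(η)` of the tangent space at `η`, the scheme-theoretic
fibre of `π` over `η`. -/
def tangentSpaceMap (K A : Type u) [CommRing K] [CommRing A] [Algebra K A]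
    (η : Spec (.of A)) :
    (tangentProj K A).fiber η ⟶ Spec ((Spec (.of A)).residueField η) :=
  (tangentProj K A).fiberToSpecResidueField η

end DiffScheme

end

open scoped TensorProduct

/-! Write `κ` for the residue field at the generic point `η`. The local ring there is
zero-dimensional and reduced, hence equal to `κ`, so `A → κ` is a localization up to isomorphism and
thus formally étale. Therefore `κ ⊗[A] Ω[A⁄K] ≃ Ω[κ⁄K]`, and the fibre of the tangent bundle is the
spectrum of `Sym_κ Ω[κ⁄K]`, a polynomial ring whose number of variables is the rank of `Ω[κ⁄K]`
(`dim_tangentSpaceMap`). In characteristic zero this rank is `trdeg_K κ`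
(`KaehlerDifferential.rank_eq_trdeg`). All equalities are between cardinals. -/

open scoped IntermediateField.algebraAdjoinAdjoin in
/-- In characteristic zero, a field extension is formally étale over the polynomial ring on any of
its transcendence bases. -/
theorem IsTranscendenceBasis.formallyEtale_aeval {K L ι : Type*} [Field K] [Field L] [Algebra K L]
    [CharZero K] {x : ι → L} (hx : IsTranscendenceBasis K x) :
    (MvPolynomial.aeval (R := K) x).toRingHom.FormallyEtale := by
  -- Factor the map as `K[X] ≃ K[x] ⊆ K(x) ⊆ L`: an isomorphism, a localization, and an algebraic
  -- extension, separable in characteristic zero.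
  have h₁ : Algebra.FormallyEtale (Algebra.adjoin K (Set.range x))
      (IntermediateField.adjoin K (Set.range x)) :=
    .of_isLocalization (nonZeroDivisors _)
  have := hx.isAlgebraic_field
  have h₂ : Algebra.FormallyEtale (IntermediateField.adjoin K (Set.range x)) L :=
    Algebra.FormallyEtale.of_isSeparable _ L
  have h₃ : Algebra.FormallyEtale (Algebra.adjoin K (Set.range x)) L :=
    .comp _ (IntermediateField.adjoin K (Set.range x)) _
  algebraize [hx.1.aevalEquiv.toAlgHom.toRingHom, (MvPolynomial.aeval (R := K) x).toRingHom]
  have : IsScalarTower (MvPolynomial ι K) (Algebra.adjoin K (Set.range x)) L :=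
    .of_algebraMap_eq fun p => (hx.1.algebraMap_aevalEquiv p).symm
  have h₄ : Algebra.Etale (MvPolynomial ι K) (Algebra.adjoin K (Set.range x)) :=
    RingHom.etale_algebraMap.mp (.of_bijective hx.1.aevalEquiv.bijective)
  exact Algebra.FormallyEtale.comp _ (Algebra.adjoin K (Set.range x)) _

/-- In characteristic zero, the dimension of the module of differentials of a field extension is its
transcendence degree. -/
theorem KaehlerDifferential.rank_eq_trdeg (K L : Type*) [Field K] [Field L] [Algebra K L]
    [CharZero K] : Module.rank L (Ω[L⁄K]) = Algebra.trdeg K L := by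
  obtain ⟨s, hs⟩ := exists_isTranscendenceBasis K L
  algebraize [(MvPolynomial.aeval (R := K) ((↑) : s → L)).toRingHom]
  have : Algebra.FormallyEtale (MvPolynomial s K) L := hs.formallyEtale_aeval
  have : IsScalarTower K (MvPolynomial s K) L := .of_algHom (MvPolynomial.aeval ((↑) : s → L))
  rw [← hs.cardinalMk_eq_trdeg,
    -- The differentials of the variables are a basis over the polynomial ring; formal étaleness
    -- carries it to `Ω[L⁄K]`.
    ← (((mvPolynomialBasis K s).baseChange L).map
      (tensorKaehlerEquivOfFormallyEtale K (MvPolynomial s K) L)).mk_eq_rank'']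

/-- Symmetric algebras commute with base change. -/
noncomputable def SymmetricAlgebra.baseChangeEquiv (A B M : Type*) [CommRing A] [CommRing B]
    [Algebra A B] [AddCommGroup M] [Module A M] :
    B ⊗[A] SymmetricAlgebra A M ≃ₐ[B] SymmetricAlgebra B (B ⊗[A] M) :=
  .ofAlgHom
    (Algebra.TensorProduct.lift (Algebra.ofId _ _)
      (lift ((ι B (B ⊗[A] M)).restrictScalars A ∘ₗ TensorProduct.mk A B M 1))
      fun _ _ => .all _ _)
    (lift ((ι A M).baseChange B))
    (by
      ext
      simp)
    (by
      ext
      simp)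

/-- Isomorphic modules have isomorphic symmetric algebras. -/
noncomputable def SymmetricAlgebra.congr {A M N : Type*} [CommRing A] [AddCommGroup M] [Module A M]
    [AddCommGroup N] [Module A N] (e : M ≃ₗ[A] N) :
    SymmetricAlgebra A M ≃ₐ[A] SymmetricAlgebra A N :=
  .ofAlgHom (lift (ι A N ∘ₗ e.toLinearMap)) (lift (ι A M ∘ₗ e.symm.toLinearMap))
    (by ext; simp) (by ext; simp)

/-- The local ring at a minimal prime is its residue field if it is reduced. -/
theorem Ideal.formallyEtale_residueField_of_isReduced {A : Type*} [CommRing A] (p : Ideal A)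
    [p.IsPrime] (hp : p ∈ minimalPrimes A) [IsReduced (Localization.AtPrime p)] :
    Algebra.FormallyEtale A p.ResidueField := by
  -- Minimality of `p` makes the localization zero-dimensional; a reduced zero-dimensional local
  -- ring is a field.
  have := Ring.KrullDimLE.of_isLocalization p hp (Localization.AtPrime p)
  have hF : IsField (Localization.AtPrime p) := Ring.KrullDimLE.isField_of_isReduced
  let _ := hF.toField
  have h₁ : Algebra.FormallyEtale A (Localization.AtPrime p) := .of_isLocalization p.primeCompl
  have h₂ : Algebra.Etale (Localization.AtPrime p) p.ResidueField :=
    RingHom.etale_algebraMap.mp <| .of_bijective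
      ⟨(algebraMap (Localization.AtPrime p) p.ResidueField).injective,
        IsLocalRing.residue_surjective⟩
  exact .comp _ (Localization.AtPrime p) _

/-- Passing to the fraction field does not change the transcendence degree. -/
theorem IsFractionRing.trdeg_eq (R B F : Type u) [CommRing R] [Nontrivial R] [CommRing B]
    [IsDomain B] [Field F] [Algebra R B] [Algebra B F] [Algebra R F] [IsScalarTower R B F]
    [IsFractionRing B F] [FaithfulSMul R B] : Algebra.trdeg R F = Algebra.trdeg R B := by
  have := IsFractionRing.comap_isAlgebraic_iff (A := B) (K := F) (C := F) |>.mpr inferInstance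
  have : FaithfulSMul B F := (faithfulSMul_iff_algebraMap_injective B F).mpr
    (IsFractionRing.injective B F)
  rw [← trdeg_add_eq R B (A := F), trdeg_eq_zero (R := B) (A := F), add_zero]

/-- The transcendence degree is invariant under isomorphisms of ring extensions. -/
theorem Algebra.trdeg_eq_of_ringEquiv {R R' A A' : Type u} [CommRing R] [CommRing R'] [CommRing A]
    [CommRing A'] [Algebra R A] [Algebra R' A'] (f : R ≃+* R') (g : A ≃+* A')
    (h : (algebraMap R' A').comp f.toRingHom = g.toRingHom.comp (algebraMap R A)) :
    Algebra.trdeg R A = Algebra.trdeg R' A' := by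
  have key (s : Set A) : AlgebraicIndepOn R _root_.id s ↔ AlgebraicIndepOn R' _root_.id (g '' s) := by
    rw [AlgebraicIndepOn, ← algebraicIndependent_ringHom_iff_of_comp_eq f g g.injective h,
      AlgebraicIndepOn]
    exact algebraicIndependent_equiv' (g.toEquiv.image s) rfl
  refine Equiv.iSup_congr ((Equiv.Set.congr g.toEquiv).subtypeEquiv key) fun s => ?_
  exact Cardinal.mk_image_eq g.injective

namespace DiffScheme

/-- The dimension at a point, computed in a model of the extension of the base ring by the residue
field. -/
theorem pointDim_eq_trdeg {k : CommRingCat.{u}} {X : Scheme.{u}} (f : X ⟶ Spec k) (x : X)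
    {k₀ L : Type u} [CommRing k₀] [CommRing L] [Algebra k₀ L] (b : CommRingCat.of k₀ ≅ k)
    (a : CommRingCat.of L ≅ X.residueField x)
    (h : Spec.map a.hom ≫ structureMap k₀ L = X.fromSpecResidueField x ≫ f ≫ Spec.map b.hom) :
    pointDim f x = Algebra.trdeg k₀ L := by
  let _ : Algebra k (X.residueField x) :=
    (Spec.preimage (X.fromSpecResidueField x ≫ f)).hom.toAlgebra
  refine (Algebra.trdeg_eq_of_ringEquiv b.commRingCatIsoToRingEquiv a.commRingCatIsoToRingEquiv
    ?_).symm
  -- This is `h` read on rings: `Spec` is faithful and reverses arrows.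
  have h' : b.hom ≫ Spec.preimage (X.fromSpecResidueField x ≫ f) =
      CommRingCat.ofHom (algebraMap k₀ L) ≫ a.hom := by
    apply Spec.map_injective
    rw [Spec.map_comp, Spec.map_preimage, Spec.map_comp, Category.assoc, ← h]
    rfl
  exact congr(($h').hom)

theorem pointDim_structureMap (K A : Type u) [CommRing K] [CommRing A] [Algebra K A]
    (x : Spec (.of A)) [x.asIdeal.IsPrime] :
    pointDim (structureMap K A) x = Algebra.trdeg K x.asIdeal.ResidueField := by
  refine pointDim_eq_trdeg (k₀ := K) (L := x.asIdeal.ResidueField) (structureMap K A)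
    x (Iso.refl _) (Scheme.Spec.residueFieldIso (.of A) x).symm ?_
  rw [← Scheme.Spec.map_residueFieldIso_inv_eq_fromSpecResidueField]
  simp only [structureMap, Iso.symm_hom, Iso.refl_hom, Spec.map_id, Category.comp_id,
    ← Spec.map_comp]
  rw [IsScalarTower.algebraMap_eq K A, CommRingCat.ofHom_comp, Category.assoc]

theorem pointDim_eq_of_iso {k k' : CommRingCat.{u}} {X X' : Scheme.{u}} {f : X ⟶ Spec k}
    {f' : X' ⟶ Spec k'} (e : X ≅ X') (b : k' ≅ k) (h : e.hom ≫ f' = f ≫ Spec.map b.hom) (x : X) :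
    pointDim f x = pointDim f' (e.hom x) := by
  let _ : Algebra k' (X'.residueField (e.hom x)) :=
    (Spec.preimage (X'.fromSpecResidueField (e.hom x) ≫ f')).hom.toAlgebra
  refine pointDim_eq_trdeg (k₀ := k') (L := X'.residueField (e.hom x)) f x b
    (asIso (e.hom.residueFieldMap x)) ?_
  have : structureMap k' (X'.residueField (e.hom x)) =
    X'.fromSpecResidueField (e.hom x) ≫ f' := Spec.map_preimage _
  rw [this, asIso_hom, Scheme.Hom.SpecMap_residueFieldMap_fromSpecResidueField_assoc, h]

theorem trdeg_residueField_of_eq_bot (k B : Type u) [Field k] [CommRing B] [IsDomain B]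
    [Algebra k B] (p : Ideal B) [p.IsPrime] (hp : p = ⊥) :
    Algebra.trdeg k p.ResidueField = Algebra.trdeg k B := by
  subst hp
  exact IsFractionRing.trdeg_eq k B _

/-- The spectrum of a domain is irreducible and its generic point is the zero ideal, so the supremum
runs over one point, with residue field `Frac B`. The isomorphism `b` allows for different models of
the base field. -/
theorem dim_eq_trdeg {k : CommRingCat.{u}} {X : Scheme.{u}} {f : X ⟶ Spec k} {k₀ B : Type u}
    [Field k₀] [CommRing B] [IsDomain B] [Algebra k₀ B] (e : X ≅ Spec (.of B))
    (b : CommRingCat.of k₀ ≅ k) (h : e.hom ≫ structureMap k₀ B = f ≫ Spec.map b.hom) :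
    dim f = Algebra.trdeg k₀ B := by
  have : IrreducibleSpace X := (Scheme.homeoOfIso e).symm.surjective.irreducibleSpace
    (Scheme.homeoOfIso e).symm.continuous
  have hX : irreducibleComponents X = {Set.univ} := irreducibleComponents_eq_singleton
  have hpt (x : {x : X // closure {x} ∈ irreducibleComponents X}) :
      pointDim f x.1 = Algebra.trdeg k₀ B := by
    obtain ⟨x, hx⟩ := x
    rw [hX, Set.mem_singleton_iff] at hx
    have : (e.hom x).asIdeal.IsPrime := PrimeSpectrum.isPrime _
    have hgen : IsGenericPoint (e.hom x) (Set.univ : Set (Spec (.of B))) := by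
      have := IsGenericPoint.image hx e.hom.continuous
      rwa [Set.image_univ, show Set.range e.hom = Set.univ from (Scheme.homeoOfIso e).surjective.range_eq, closure_univ] at this
    have hbot : e.hom x = (⊥ : PrimeSpectrum B) := by
      rw [← genericPoint_eq_bot_of_affine (.of B)]
      exact hgen.eq (genericPoint_spec _)
    refine (pointDim_eq_of_iso e b h x).trans <| (pointDim_structureMap k₀ B _).trans ?_
    exact trdeg_residueField_of_eq_bot k₀ B _ congr(PrimeSpectrum.asIdeal $hbot)
  -- Needed for `ciSup_const`: a supremum over an empty family would be `0`.
  have : Nonempty {x : X // closure {x} ∈ irreducibleComponents X} :=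
    ⟨genericPoint X, by rw [hX]; exact genericPoint_closure X⟩
  rw [dim, funext hpt, ciSup_const]

end DiffScheme

/-- The generic point of an irreducible component is a minimal prime. -/
theorem PrimeSpectrum.asIdeal_mem_minimalPrimes_of_isGenericPoint {A : Type*} [CommRing A]
    {x : PrimeSpectrum A} {Z : Set (PrimeSpectrum A)} (hx : IsGenericPoint x Z)
    (hZ : Z ∈ irreducibleComponents (PrimeSpectrum A)) : x.asIdeal ∈ minimalPrimes A := by
  rwa [← vanishingIdeal_singleton, vanishingIdeal_mem_minimalPrimes, hx]

namespace DiffScheme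

/-- The fibre of the tangent bundle at a point whose residue field is formally étale over the base
has dimension the rank of the differentials of the residue field. -/
theorem dim_tangentSpaceMap (K A : Type u) [Field K] [CommRing A] [Algebra K A]
    (η : Spec (.of A)) [η.asIdeal.IsPrime] [Algebra.FormallyEtale A η.asIdeal.ResidueField] :
    dim (tangentSpaceMap K A η) =
      Module.rank η.asIdeal.ResidueField (Ω[η.asIdeal.ResidueField⁄K]) := by
  let κ := η.asIdeal.ResidueField
  let S := SymmetricAlgebra A (Ω[A⁄K])
  let b := Module.Free.chooseBasis κ (Ω[κ⁄K])
  let E : η.asIdeal.Fiber S ≃ₐ[κ] MvPolynomial _ κ :=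
    (SymmetricAlgebra.baseChangeEquiv A κ (Ω[A⁄K])).trans <|
      (SymmetricAlgebra.congr (KaehlerDifferential.tensorKaehlerEquivOfFormallyEtale K A κ)).trans
        (SymmetricAlgebra.equivMvPolynomial b)
  have : IsDomain (η.asIdeal.Fiber S) := E.toMulEquiv.isDomain _
  let e := Spec.fiberToSpecResidueFieldIso A S η
  have h := dim_eq_trdeg (f := tangentSpaceMap K A η) (k₀ := κ) (B := η.asIdeal.Fiber S)
    (Arrow.leftFunc.mapIso e) (Scheme.Spec.residueFieldIso (.of A) η).symm (Arrow.w e.hom)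
  rw [h, E.trdeg_eq, MvPolynomial.trdeg_of_isDomain, Cardinal.lift_id, b.mk_eq_rank'']

end DiffScheme

theorem mainTheorem4 (K : Type u) [Field K] [CharZero K] [Differential K] (n : ℕ)
    (f : Fin n → DiffScheme.DiffPoly K n)
    (Z : Set (Spec (.of (DiffScheme.coordRing f))))
    (hZ : Z ∈ irreducibleComponents (Spec (.of (DiffScheme.coordRing f))))
    (hdim : topologicalKrullDim Z < ⊤)
    (η : Spec (.of (DiffScheme.coordRing f))) (hη : IsGenericPoint η Z)
    (hred : _root_.IsReduced ((Spec (.of (DiffScheme.coordRing f))).presheaf.stalk η)) :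
    DiffScheme.pointDim (DiffScheme.structureMap K (DiffScheme.coordRing f)) η =
      DiffScheme.dim (DiffScheme.tangentSpaceMap K (DiffScheme.coordRing f) η) := by
  have hprime : η.asIdeal.IsPrime := PrimeSpectrum.isPrime _
  have hmin : η.asIdeal ∈ minimalPrimes (DiffScheme.coordRing f) :=
    PrimeSpectrum.asIdeal_mem_minimalPrimes_of_isGenericPoint hη hZ
  -- Reducedness passes from the stalk to the isomorphic algebraic localization.
  have : _root_.IsReduced (Localization.AtPrime η.asIdeal) :=
    isReduced_of_injective _
      (Spec.stalkIso (.of (DiffScheme.coordRing f)) η).commRingCatIsoToRingEquiv.symm.injective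
  have := η.asIdeal.formallyEtale_residueField_of_isReduced hmin
  rw [DiffScheme.pointDim_structureMap, DiffScheme.dim_tangentSpaceMap,
    KaehlerDifferential.rank_eq_trdeg]
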